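/- Let $k$ be an indeterminate over $\mathbb{Q}$ and put $$a=5k^2-4k+4,\qquad b=\tfrac12\,k\,(k^2-4k+20),\qquad c=\tfrac12\,(k+2)(k^2-4)$$ in the rational function field $\mathbb{Q}(k)$. Then $$E:\ y^2=(x+ab)(x+bc)(x+ac)$$ is an elliptic curve over $\mathbb{Q}(k)$, and the torsion subgroup of $E(\mathbb{Q}(k))$ is isomorphic to $\mathbb{Z}/2\mathbb{Z}\times\mathbb{Z}/2\mathbb{Z}$. It is generated by the points $(-ab,0)$, $(-bc,0)$, $(-ac,0)$; explicitly, $$E(\mathbb{Q}(k))_{\mathrm{tors}}=\{\infty,\ (-ab,0),\ (-bc,0),\ (-ac,0)\}.$$ -/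

import Mathlib

/-- The first side `a(k) = 5k² - 4k + 4`, as an element of `ℚ(k)`. -/
noncomputable def sideA : RatFunc ℚ :=
  5 * RatFunc.X ^ 2 - 4 * RatFunc.X + 4

/-- The second side `b(k) = k(k² - 4k + 20)/2`, as an element of `ℚ(k)`. -/
noncomputable def sideB : RatFunc ℚ :=
  RatFunc.X * (RatFunc.X ^ 2 - 4 * RatFunc.X + 20) / 2

/-- The third side `c(k) = (k + 2)(k² - 4)/2`, as an element of `ℚ(k)`. -/
noncomputable def sideC : RatFunc ℚ :=
  (RatFunc.X + 2) * (RatFunc.X ^ 2 - 4) / 2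

/-- The curve `y² = (x + ab)(x + bc)(x + ac)` over a field, as a Weierstrass curve:
the coefficients are those of the expanded cubic. -/
def triangleCurve {F : Type*} [Field F] (a b c : F) : WeierstrassCurve.Affine F where
  a₁ := 0
  a₂ := a * b + b * c + a * c
  a₃ := 0
  a₄ := a * b * (b * c) + a * b * (a * c) + b * c * (a * c)
  a₆ := a * b * (b * c) * (a * c)

/-- The affine equation of `triangleCurve a b c` is `y² = (x + ab)(x + bc)(x + ac)`. -/
theorem triangleCurve_equation_iff {F : Type*} [Field F] (a b c x y : F) :
    (triangleCurve a b c).Equation x y ↔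
      y ^ 2 = (x + a * b) * (x + b * c) * (x + a * c) := by
  rw [WeierstrassCurve.Affine.equation_iff]
  simp only [triangleCurve]
  constructor <;> intro h <;> linear_combination h

/-- The elliptic curve attached to the triangle with sides `a(k)`, `b(k)`, `c(k)`, over `ℚ(k)`. -/
noncomputable def heronCurve : WeierstrassCurve.Affine (RatFunc ℚ) :=
  triangleCurve sideA sideB sideC

open WeierstrassCurve Affine

/-! ### Doubling and integrality on `y² = (x + ab)(x + bc)(x + ac)` -/

section TriangleCurve

/-! Torsion splits into an odd part, shown to be trivial, and a 2-primary part, shown to be killed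
by 2.

Odd part: if `P` has odd order then `2 ^ n • P = P` for some `n > 0`. A pole of `x` at a finite
place would survive repeated doubling, with `x` scaled by `1/4` each time up to smaller terms, so
`P` could not return to itself; hence `x` is a polynomial. Moreover `P` is a double, so `x + ab`, `x
+ bc`, `x + ac` are squares `U²`, `V²`, `W²` of polynomials. Since `a` and `b - c` are prime in
`ℚ[X]`, the factorisation `(U + W)(U - W) = a(b - c)` leaves two shapes for `U`, and `U² - V² = b(a
- c)` leaves only `U = ±(a + b - c)/2` (`four_mul_sq_eq`). This value belongs to the double of the
rational point `(0, abc)`, so squareness alone cannot exclude it. But `2P` is also of odd order,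
hence has the same `x` as `P`, and the duplication formula at `k = 1` refutes this
(`eq_zero_of_odd`).

2-primary part: if a point of order two were a double, certain products such as `a(b - c)` would be
squares; their values at `k = 1` are not (`two_nsmul_ne_some_zero`). So there is no point of order
4. -/

theorem triangleCurve_negY {F : Type*} [Field F] {a b c : F} (x y : F) :
    (triangleCurve a b c).negY x y = -y := by
  simp [negY, triangleCurve]

variable {F : Type*} [Field F] [DecidableEq F] {a b c : F}

theorem triangleCurve_two_nsmul_of_y_eq_zero {x y : F} (h : (triangleCurve a b c).Nonsingular x y)
    (hy : y = 0) : 2 • Point.some x y h = 0 := by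
  rw [two_nsmul]
  exact Point.add_self_of_Y_eq (by rw [triangleCurve_negY, hy, neg_zero])

/-- Doubling: `x(2P) - e` is a square for each root `e` of the cubic. -/
theorem triangleCurve_two_nsmul (h2 : (2 : F) ≠ 0) {x y : F}
    (h : (triangleCurve a b c).Nonsingular x y) (hy : y ≠ 0) :
    ∃ (x' y' : F) (h' : (triangleCurve a b c).Nonsingular x' y'),
      2 • Point.some x y h = Point.some x' y' h' ∧
      (x' + a * b) * (2 * y) ^ 2 =
        ((x + a * b) ^ 2 - (b * c - a * b) * (a * c - a * b)) ^ 2 ∧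
      (x' + b * c) * (2 * y) ^ 2 =
        ((x + b * c) ^ 2 - (a * b - b * c) * (a * c - b * c)) ^ 2 ∧
      (x' + a * c) * (2 * y) ^ 2 =
        ((x + a * c) ^ 2 - (a * b - a * c) * (b * c - a * c)) ^ 2 := by
  have hne : y ≠ (triangleCurve a b c).negY x y := by
    rw [triangleCurve_negY]
    intro e
    exact mul_ne_zero h2 hy (by linear_combination e)
  have heq := (triangleCurve_equation_iff a b c x y).1 h.1
  have h2y : 2 * y ≠ 0 := mul_ne_zero h2 hy
  set ℓ := (triangleCurve a b c).slope x x y y with hℓ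
  have hs : ℓ * (2 * y) = 3 * x ^ 2 + 2 * (a * b + b * c + a * c) * x +
      (a * b * (b * c) + a * b * (a * c) + b * c * (a * c)) := by
    rw [hℓ, slope_of_Y_ne rfl hne, triangleCurve_negY]
    have : y - -y = 2 * y := by ring
    rw [this, div_mul_cancel₀ _ h2y]
    simp [triangleCurve]
  have hx : (triangleCurve a b c).addX x x ℓ = ℓ ^ 2 - (a * b + b * c + a * c) - 2 * x := by
    simp only [addX, triangleCurve]; ring
  refine ⟨_, _, _, (two_nsmul _).trans (Point.add_self_of_Y_ne hne), ?_⟩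
  rw [← hℓ, hx]
  have hs2 : ℓ ^ 2 * (2 * y) ^ 2 = (3 * x ^ 2 + 2 * (a * b + b * c + a * c) * x +
      (a * b * (b * c) + a * b * (a * c) + b * c * (a * c))) ^ 2 := by rw [← hs]; ring
  refine ⟨?_, ?_, ?_⟩
  · linear_combination hs2 - 4 * (b * c + a * c + 2 * x) * heq
  · linear_combination hs2 - 4 * (a * b + a * c + 2 * x) * heq
  · linear_combination hs2 - 4 * (a * b + b * c + 2 * x) * heq

/-- Euler's theorem: `2 ^ φ(m) ≡ 1` modulo odd `m`. A point of odd order is thus recovered by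
repeated doubling, and is itself a double. -/
theorem exists_two_pow_nsmul_eq_self {G : Type*} [AddCommGroup G] {P : G} {m : ℕ} (hm : Odd m)
    (hP : m • P = 0) : ∃ n : ℕ, n ≠ 0 ∧ 2 ^ n • P = P := by
  refine ⟨m.totient, (Nat.totient_pos.2 hm.pos).ne', ?_⟩
  obtain ⟨k, hk⟩ := (Nat.modEq_iff_dvd' Nat.one_le_two_pow).1
    (Nat.ModEq.pow_totient (Nat.coprime_two_left.2 hm)).symm
  have : 2 ^ m.totient = k * m + 1 := by
    have := Nat.one_le_two_pow (n := m.totient)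
    rw [mul_comm]; omega
  rw [this, add_nsmul, mul_nsmul', hP, nsmul_zero, zero_add, one_nsmul]

/-- In residue characteristic zero the first coordinate of a point of odd order is integral. -/
theorem triangleCurve_valuation_le_one {Γ : Type*} [LinearOrderedCommGroupWithZero Γ]
    (v : Valuation F Γ) (hv : ∀ n : ℕ, n ≠ 0 → v n = 1) (ha : v a ≤ 1) (hb : v b ≤ 1)
    (hc : v c ≤ 1) {x y : F} (h : (triangleCurve a b c).Nonsingular x y) {m : ℕ} (hm : Odd m)
    (hP : m • Point.some x y h = 0) : v x ≤ 1 := by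
  have hab : v (a * b) ≤ 1 := by rw [map_mul]; exact mul_le_one' ha hb
  have hbc : v (b * c) ≤ 1 := by rw [map_mul]; exact mul_le_one' hb hc
  have hac : v (a * c) ≤ 1 := by rw [map_mul]; exact mul_le_one' ha hc
  have h2 : (2 : F) ≠ 0 := by
    have := hv 2 two_ne_zero
    intro h0
    simp [h0] at this
  by_contra! hx
  set X := x + a * b with hX
  have hvX : 1 < v X := by
    rwa [hX, Valuation.map_add_eq_of_lt_left v (hab.trans_lt hx)]
  -- One doubling multiplies the coordinate by `1/4` up to smaller terms.
  have step : ∀ (x y : F) (h : (triangleCurve a b c).Nonsingular x y), 1 < v (x + a * b) →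
      ∃ (x' y' : F) (h' : (triangleCurve a b c).Nonsingular x' y'),
        2 • Point.some x y h = Point.some x' y' h' ∧
        v (4 * (x' + a * b) - (x + a * b)) < v (x + a * b) := by
    intro x y h hx
    have heq := (triangleCurve_equation_iff a b c x y).1 h.1
    set X := x + a * b with hX
    set p := b * c - a * b with hp
    set q := a * c - a * b with hq
    have hvp : v p ≤ 1 := (v.map_sub _ _).trans (max_le hbc hab)
    have hvq : v q ≤ 1 := (v.map_sub _ _).trans (max_le hac hab)
    have e1 : x + b * c = X + p := by rw [hX, hp]; ring
    have e2 : x + a * c = X + q := by rw [hX, hq]; ring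
    have w1 : v (X + p) = v X := Valuation.map_add_eq_of_lt_left v (hvp.trans_lt hx)
    have w2 : v (X + q) = v X := Valuation.map_add_eq_of_lt_left v (hvq.trans_lt hx)
    rw [e1, e2] at heq
    have hX0 : v X ≠ 0 := (zero_lt_one.trans hx).ne'
    have hy : y ≠ 0 := by
      rintro rfl
      have := congrArg v heq
      simp only [map_mul, w1, w2] at this
      simp [hX0] at this
    obtain ⟨x', y', h', e, d, -⟩ := triangleCurve_two_nsmul h2 h hy
    refine ⟨x', y', h', e, ?_⟩
    -- Since `(2y)² = 4X(X + p)(X + q)`, clearing denominators cancels the `X ^ 4` terms, leaving a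
    -- right side of size at most `v X ^ 3`.
    have key : (4 * (x' + a * b) - X) * (X * (X + p) * (X + q)) =
        X ^ 3 * (-(p + q)) + X ^ 2 * (-(3 * (p * q))) + (p * q) ^ 2 := by
      linear_combination d - 4 * (x' + a * b) * heq
    have hpq : v (p * q) ≤ 1 := by rw [map_mul]; exact mul_le_one' hvp hvq
    have hle : v (X ^ 3 * (-(p + q)) + X ^ 2 * (-(3 * (p * q))) + (p * q) ^ 2) ≤ v X ^ 3 := by
      refine (v.map_add _ _).trans (max_le ((v.map_add _ _).trans (max_le ?_ ?_)) ?_)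
      · rw [map_mul, map_pow, Valuation.map_neg]
        exact mul_le_of_le_one_right' ((v.map_add _ _).trans (max_le hvp hvq))
      · have h3 : v (3 : F) = 1 := by exact_mod_cast hv 3 (by norm_num)
        rw [map_mul, map_pow, Valuation.map_neg, map_mul, h3, one_mul]
        exact (mul_le_of_le_one_right' hpq).trans (pow_le_pow_right₀ hx.le (by norm_num))
      · rw [map_pow]
        exact (pow_le_one' hpq 2).trans (one_le_pow_of_one_le' hx.le 3)
    rw [← key, map_mul, map_mul, map_mul, w1, w2] at hle
    have hpos : 0 < v X ^ 3 := pow_pos (zero_lt_one.trans hx) 3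
    have e3 : v X * v X * v X = v X ^ 3 := by rw [pow_succ, pow_two]
    rw [e3] at hle
    have h1 : v (4 * (x' + a * b) - X) ≤ 1 :=
      le_of_mul_le_mul_right (by rwa [one_mul]) hpos
    exact h1.trans_lt hx
  have iter : ∀ n : ℕ, ∃ (x' y' : F) (h' : (triangleCurve a b c).Nonsingular x' y'),
      2 ^ n • Point.some x y h = Point.some x' y' h' ∧ v (4 ^ n * (x' + a * b) - X) < v X := by
    intro n
    induction n with
    | zero => exact ⟨x, y, h, by simp, by simpa [← hX] using zero_lt_one.trans hvX⟩
    | succ n ih =>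
      obtain ⟨x₁, y₁, h₁, e₁, l₁⟩ := ih
      have h4 : v (4 ^ n : F) = 1 := by
        have h4 : v (4 : F) = 1 := by exact_mod_cast hv 4 (by norm_num)
        rw [map_pow, h4, one_pow]
      have hX₁ : v (x₁ + a * b) = v X := by
        have := Valuation.map_add_eq_of_lt_right v l₁
        rwa [sub_add_cancel, map_mul, h4, one_mul] at this
      obtain ⟨x₂, y₂, h₂, e₂, l₂⟩ := step x₁ y₁ h₁ (by rwa [hX₁])
      refine ⟨x₂, y₂, h₂, by rw [pow_succ, mul_nsmul, e₁, e₂], ?_⟩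
      have : 4 ^ (n + 1) * (x₂ + a * b) - X =
          4 ^ n * (4 * (x₂ + a * b) - (x₁ + a * b)) + (4 ^ n * (x₁ + a * b) - X) := by ring
      rw [this]
      refine v.map_add_lt ?_ l₁
      rw [map_mul, h4, one_mul, ← hX₁]
      exact l₂
  -- With `2 ^ n • P = P` the estimate reads `v ((4 ^ n - 1) * X) < v X`, absurd because `4 ^ n - 1`
  -- is a nonzero integer and so a unit.
  obtain ⟨n, hn, hfix⟩ := exists_two_pow_nsmul_eq_self hm hP
  obtain ⟨x', y', h', e, l⟩ := iter n
  rw [hfix] at e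
  obtain ⟨rfl, -⟩ := (Point.some.injEq ..).mp e
  have h41 : 4 ^ n - 1 ≠ 0 := by
    have := Nat.one_lt_pow hn (by norm_num : 1 < 4)
    omega
  have hu := hv _ h41
  rw [Nat.cast_sub (by omega)] at hu
  rw [← hX, show (4 : F) ^ n * X - X = (((4 ^ n : ℕ) : F) - ((1 : ℕ) : F)) * X by push_cast; ring,
    map_mul, hu, one_mul] at l
  exact lt_irrefl _ l

end TriangleCurve

/-! ### Differences of squares in `ℚ[X]` -/

section Sides

open Polynomial

/-- The side `a(k)` as a polynomial. -/
noncomputable def polyA : ℚ[X] := 5 * X ^ 2 - 4 * X + 4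

/-- The side `b(k)` as a polynomial. -/
noncomputable def polyB : ℚ[X] := C (1 / 2) * (X * (X ^ 2 - 4 * X + 20))

/-- The side `c(k)` as a polynomial. -/
noncomputable def polyC : ℚ[X] := C (1 / 2) * ((X + 2) * (X ^ 2 - 4))

theorem polyA_eval (t : ℚ) : polyA.eval t = 5 * t ^ 2 - 4 * t + 4 := by
  simp [polyA]

theorem polyB_eval (t : ℚ) : polyB.eval t = 1 / 2 * (t * (t ^ 2 - 4 * t + 20)) := by
  simp [polyB]

theorem polyC_eval (t : ℚ) : polyC.eval t = 1 / 2 * ((t + 2) * (t ^ 2 - 4)) := by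
  simp [polyC]

theorem polyB_sub_polyC_eq : polyB - polyC = C (-3) * X ^ 2 + C 12 * X + C 4 := by
  refine Polynomial.funext fun t => ?_
  simp only [eval_sub, polyB_eval, polyC_eval, eval_add, eval_mul, eval_C, eval_pow, eval_X]
  ring

theorem polyA_eq : polyA = C 5 * X ^ 2 + C (-4) * X + C 4 := by
  refine Polynomial.funext fun t => ?_
  simp only [polyA_eval, eval_add, eval_mul, eval_C, eval_pow, eval_X]
  ring

theorem prime_quadratic {p q r : ℚ} (hp : p ≠ 0) (hd : ¬ IsSquare (discrim p q r)) :
    Prime (C p * X ^ 2 + C q * X + C r) := by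
  refine (irreducible_of_degree_le_three_of_not_isRoot ?_ fun t ht => hd ?_).prime
  · rw [natDegree_quadratic hp]; simp
  · rw [IsRoot.def] at ht
    simp only [eval_add, eval_mul, eval_C, eval_pow, eval_X] at ht
    exact ⟨2 * p * t + q, by rw [discrim]; linear_combination (-4 * p) * ht⟩

theorem prime_polyA : Prime polyA := by
  rw [polyA_eq]
  refine prime_quadratic (by norm_num) ?_
  rintro ⟨t, ht⟩
  norm_num [discrim] at ht
  nlinarith [mul_self_nonneg t]

theorem prime_polyB_sub_polyC : Prime (polyB - polyC) := by
  rw [polyB_sub_polyC_eq]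
  refine prime_quadratic (by norm_num) ?_
  rintro ⟨t, ht⟩
  norm_num [discrim] at ht
  have : IsSquare (192 : ℚ) := ⟨t, ht⟩
  rw [show (192 : ℚ) = ((192 : ℕ) : ℚ) by norm_num, Rat.isSquare_natCast_iff] at this
  revert this
  decide +kernel

theorem coeff_eq_zero_of_forall {c₀ c₁ c₂ c₃ c₄ c₅ c₆ c₇ c₈ : ℚ}
    (h : ∀ t : ℚ, c₀ + c₁ * t + c₂ * t ^ 2 + c₃ * t ^ 3 + c₄ * t ^ 4 + c₅ * t ^ 5 + c₆ * t ^ 6 +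
      c₇ * t ^ 7 + c₈ * t ^ 8 = 0) :
    c₀ = 0 ∧ c₁ = 0 ∧ c₂ = 0 ∧ c₃ = 0 ∧ c₄ = 0 ∧ c₅ = 0 ∧ c₆ = 0 ∧ c₇ = 0 ∧ c₈ = 0 := by
  have e : C c₀ + C c₁ * X + C c₂ * X ^ 2 + C c₃ * X ^ 3 + C c₄ * X ^ 4 + C c₅ * X ^ 5 +
      C c₆ * X ^ 6 + C c₇ * X ^ 7 + C c₈ * X ^ 8 = 0 :=
    Polynomial.funext fun t => by simpa using h t
  have k : ∀ n, _ := fun n => congrArg (coeff · n) e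
  simp only [coeff_add, coeff_C_mul, coeff_X_pow, coeff_C, coeff_X, coeff_zero] at k
  exact ⟨by simpa using k 0, by simpa using k 1, by simpa using k 2, by simpa using k 3,
    by simpa using k 4, by simpa using k 5, by simpa using k 6, by simpa using k 7,
    by simpa using k 8⟩

theorem exists_eval_eq_of_natDegree_le_four {V : ℚ[X]} (hV : V.natDegree ≤ 4) :
    ∃ v₀ v₁ v₂ v₃ v₄ : ℚ, ∀ t, V.eval t = v₀ + v₁ * t + v₂ * t ^ 2 + v₃ * t ^ 3 + v₄ * t ^ 4 := by
  refine ⟨V.coeff 0, V.coeff 1, V.coeff 2, V.coeff 3, V.coeff 4, fun t => ?_⟩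
  rw [eval_eq_sum_range' (Nat.lt_succ_of_le hV)]
  simp [Finset.sum_range_succ]

/-- Substituting `r = 1/s` turns both equations into polynomials in `s` whose only common root is `s
= -1`. -/
theorem eq_of_leading_coeff_equations {s r : ℚ} (hsr : s * r = 1)
    (h₁ : 55 * s ^ 2 - 9 * r ^ 2 - 54 = 4 * (s + r))
    (h₂ : 8 * (s + r) * (10 + (5 * s - 3 * r) ^ 2 / 2) - 32 * (s + r) * (-s + 3 * r) + 320 = 0) :
    s = r := by
  have p2 : s ^ 2 * r ^ 2 = 1 := by rw [← mul_pow, hsr, one_pow]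
  have p3 : s ^ 3 * r ^ 3 = 1 := by rw [← mul_pow, hsr, one_pow]
  have e₁ : (s + 1) * (55 * s ^ 3 - 59 * s ^ 2 + 5 * s - 9) = 0 := by
    linear_combination s ^ 2 * h₁ + 9 * p2 + 4 * s * hsr
  have e₂ : (s + 1) *
      (50 * s ^ 5 - 34 * s ^ 4 + 64 * s ^ 3 + 64 * s ^ 2 - 66 * s + 18) = 0 := by
    linear_combination s ^ 3 / 2 * h₂ - (40 * s ^ 2 - 10 * s ^ 4 - 32 * s ^ 3) * hsr +
      (42 * s ^ 2 + 48 * s) * p2 - 18 * p3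
  by_cases hs : s + 1 = 0
  · obtain rfl : s = -1 := by linear_combination hs
    linear_combination hsr
  · have f₁ := (mul_eq_zero.1 e₁).resolve_left hs
    have f₂ := (mul_eq_zero.1 e₂).resolve_left hs
    -- The cofactors left after removing `s + 1` are coprime; this is their Bézout identity with
    -- denominators cleared.
    have : (90501120 : ℚ) = 0 := by
      linear_combination (-9533094 + 6531812 * s + 5878844 * s ^ 2 - 4157372 * s ^ 3 +
        5321650 * s ^ 4) * f₁ + (261293 + 6872062 * s - 5853815 * s ^ 2) * f₂
    norm_num at this

/-- This is `(2V)² = (2U)² - 4b(a - c)` for `2U = s a + r (b - c)`. The coefficients from degree 8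
down to 3 determine `2V` up to sign; those of degrees 1 and 0 then constrain `s` and `r`. -/
theorem eq_of_quadratic_splitting {s r : ℚ} (hsr : s * r = 1) {t₀ t₁ t₂ t₃ t₄ : ℚ}
    (h : ∀ t : ℚ, (t₀ + t₁ * t + t₂ * t ^ 2 + t₃ * t ^ 3 + t₄ * t ^ 4) ^ 2 =
      ((5 * s - 3 * r) * t ^ 2 + (-4 * s + 12 * r) * t + (4 * s + 4 * r)) ^ 2 +
      (t ^ 6 - 12 * t ^ 5 + 56 * t ^ 4 - 192 * t ^ 3 + 144 * t ^ 2 - 320 * t)) :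
    s = r := by
  set p := 5 * s - 3 * r with hp
  set q := -4 * s + 12 * r with hq
  set w := 4 * s + 4 * r with hw
  obtain ⟨k0, k1, k2, k3, k4, k5, k6, -, k8⟩ := coeff_eq_zero_of_forall
    (c₀ := t₀ ^ 2 - w ^ 2) (c₁ := 2 * t₀ * t₁ - 2 * w * q + 320)
    (c₂ := 2 * t₀ * t₂ + t₁ ^ 2 - 2 * w * p - q ^ 2 - 144)
    (c₃ := 2 * t₀ * t₃ + 2 * t₁ * t₂ - 2 * p * q + 192)
    (c₄ := 2 * t₀ * t₄ + 2 * t₁ * t₃ + t₂ ^ 2 - p ^ 2 - 56)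
    (c₅ := 2 * t₁ * t₄ + 2 * t₂ * t₃ + 12) (c₆ := 2 * t₂ * t₄ + t₃ ^ 2 - 1)
    (c₇ := 2 * t₃ * t₄) (c₈ := t₄ ^ 2)
    (fun t => by linear_combination h t)
  have h4 : t₄ = 0 := by simpa using k8
  subst h4
  have h3 : t₃ ^ 2 = 1 := by linear_combination k6
  -- Multiplying through with `t₃` normalises the cubic to be monic.
  have h2 : t₃ * t₂ = -6 := by linear_combination k5 / 2
  have h1 : t₃ * t₁ = 10 + p ^ 2 / 2 := by
    linear_combination k4 / 2 + t₂ ^ 2 / 2 * h3 - (t₃ * t₂ - 6) / 2 * h2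
  have h0 : t₃ * t₀ = 55 * s ^ 2 - 9 * r ^ 2 - 54 := by
    linear_combination k3 / 2 + t₁ * t₂ * h3 - t₃ * t₁ * h2 + 6 * h1 - 18 * hsr
  have h01 : 2 * (t₃ * t₀) * (10 + p ^ 2 / 2) - 2 * w * q + 320 = 0 := by
    rw [← h1]
    linear_combination k1 + 2 * t₀ * t₁ * h3
  have hfac : (t₃ * t₀ - w) * (t₃ * t₀ + w) = 0 := by linear_combination t₃ ^ 2 * k0 + w ^ 2 * h3
  rcases mul_eq_zero.1 hfac with h | h
  · have e : t₃ * t₀ = w := by linear_combination h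
    rw [e] at h0 h01
    exact eq_of_leading_coeff_equations hsr (by linear_combination -h0)
      (by linear_combination h01)
  · have e : t₃ * t₀ = -w := by linear_combination h
    rw [e] at h0 h01
    exact neg_injective (eq_of_leading_coeff_equations (s := -s) (r := -r) (by linear_combination hsr)
      (by linear_combination -h0) (by linear_combination h01))

/-- Here `2U = s a(b - c) + r`. Degrees 7, 6, 5 give `t₃`, `t₂`, `t₁`, and degree 0 gives `t₀` up to
sign. -/
theorem not_quartic_splitting_of_leading_coeff {s r : ℚ} (hsr : s * r = 1) {t₀ t₁ t₂ t₃ : ℚ}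
    (h : ∀ t : ℚ, (t₀ + t₁ * t + t₂ * t ^ 2 + t₃ * t ^ 3 + -15 * s * t ^ 4) ^ 2 =
      (s * ((5 * t ^ 2 - 4 * t + 4) * (-3 * t ^ 2 + 12 * t + 4)) + r) ^ 2 +
      (t ^ 6 - 12 * t ^ 5 + 56 * t ^ 4 - 192 * t ^ 3 + 144 * t ^ 2 - 320 * t)) :
    False := by
  obtain ⟨k0, -, -, k3, k4, k5, k6, k7, -⟩ := coeff_eq_zero_of_forall
    (c₀ := t₀ ^ 2 - (16 * s + r) ^ 2) (c₁ := 2 * t₀ * t₁ - 2 * (16 * s + r) * (32 * s) + 320)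
    (c₂ := 2 * t₀ * t₂ + t₁ ^ 2 - 2 * (16 * s + r) * (-40 * s) - (32 * s) ^ 2 - 144)
    (c₃ := 2 * t₀ * t₃ + 2 * t₁ * t₂ - 2 * (16 * s + r) * (72 * s)
      - 2 * (32 * s) * (-40 * s) + 192)
    (c₄ := 2 * t₀ * (-15 * s) + 2 * t₁ * t₃ + t₂ ^ 2 - 2 * (16 * s + r) * (-15 * s)
      - 2 * (32 * s) * (72 * s) - (-40 * s) ^ 2 - 56)
    (c₅ := 2 * t₁ * (-15 * s) + 2 * t₂ * t₃ - 2 * (32 * s) * (-15 * s)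
      - 2 * (-40 * s) * (72 * s) + 12)
    (c₆ := 2 * t₂ * (-15 * s) + t₃ ^ 2 - 2 * (-40 * s) * (-15 * s) - (72 * s) ^ 2 - 1)
    (c₇ := 2 * t₃ * (-15 * s) - 2 * (72 * s) * (-15 * s)) (c₈ := 0)
    (fun t => by linear_combination h t)
  obtain rfl : t₃ = 72 * s := by linear_combination (-r / 30) * k7 - (t₃ - 72 * s) * hsr
  obtain rfl : t₂ = -40 * s - r / 30 := by
    linear_combination (-r / 30) * k6 - (t₂ + 40 * s) * hsr
  obtain rfl : t₁ = 32 * s + 6 / 25 * r := by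
    linear_combination (-r / 30) * k5 - (t₁ - 32 * s + 4 / 25 * r) * hsr
  have hfac : (t₀ - (16 * s + r)) * (t₀ + (16 * s + r)) = 0 := by linear_combination k0
  rcases mul_eq_zero.1 hfac with e | e
  · obtain rfl : t₀ = 16 * s + r := by linear_combination e
    -- With this sign the `s²` terms cancel, and degrees 3 and 4 prescribe different values of `r²`.
    ring_nf at k3 k4
    rw [mul_comm] at hsr
    nlinarith
  · obtain rfl : t₀ = -(16 * s + r) := by linear_combination e
    -- With this sign the degree 4 coefficient is a positive constant plus positive multiples of
    -- `s²` and `r²`.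
    nlinarith [sq_nonneg s, sq_nonneg r]

theorem not_quartic_splitting {s r : ℚ} (hsr : s * r = 1) {t₀ t₁ t₂ t₃ t₄ : ℚ}
    (h : ∀ t : ℚ, (t₀ + t₁ * t + t₂ * t ^ 2 + t₃ * t ^ 3 + t₄ * t ^ 4) ^ 2 =
      (s * ((5 * t ^ 2 - 4 * t + 4) * (-3 * t ^ 2 + 12 * t + 4)) + r) ^ 2 +
      (t ^ 6 - 12 * t ^ 5 + 56 * t ^ 4 - 192 * t ^ 3 + 144 * t ^ 2 - 320 * t)) :
    False := by
  have h8 := (coeff_eq_zero_of_forall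
    (c₀ := t₀ ^ 2 - (16 * s + r) ^ 2) (c₁ := 2 * t₀ * t₁ - 2 * (16 * s + r) * (32 * s) + 320)
    (c₂ := 2 * t₀ * t₂ + t₁ ^ 2 - 2 * (16 * s + r) * (-40 * s) - (32 * s) ^ 2 - 144)
    (c₃ := 2 * t₀ * t₃ + 2 * t₁ * t₂ - 2 * (16 * s + r) * (72 * s)
      - 2 * (32 * s) * (-40 * s) + 192)
    (c₄ := 2 * t₀ * t₄ + 2 * t₁ * t₃ + t₂ ^ 2 - 2 * (16 * s + r) * (-15 * s)
      - 2 * (32 * s) * (72 * s) - (-40 * s) ^ 2 - 56)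
    (c₅ := 2 * t₁ * t₄ + 2 * t₂ * t₃ - 2 * (32 * s) * (-15 * s) - 2 * (-40 * s) * (72 * s) + 12)
    (c₆ := 2 * t₂ * t₄ + t₃ ^ 2 - 2 * (-40 * s) * (-15 * s) - (72 * s) ^ 2 - 1)
    (c₇ := 2 * t₃ * t₄ - 2 * (72 * s) * (-15 * s)) (c₈ := t₄ ^ 2 - (-15 * s) ^ 2)
    (fun t => by linear_combination h t)).2.2.2.2.2.2.2.2
  have hfac : (t₄ - -15 * s) * (t₄ + -15 * s) = 0 := by linear_combination h8
  rcases mul_eq_zero.1 hfac with e | e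
  · obtain rfl : t₄ = -15 * s := by linear_combination e
    exact not_quartic_splitting_of_leading_coeff hsr h
  · obtain rfl : t₄ = 15 * s := by linear_combination e
    exact not_quartic_splitting_of_leading_coeff hsr (t₀ := -t₀) (t₁ := -t₁) (t₂ := -t₂)
      (t₃ := -t₃) fun t => by linear_combination h t

theorem natDegree_le_four_of_sq_eq {T U : ℚ[X]} (hU : U.natDegree ≤ 4)
    (h : T ^ 2 = U ^ 2 - C 4 * (polyB * (polyA - polyC))) : T.natDegree ≤ 4 := by
  have hd : (C 4 * (polyB * (polyA - polyC))).natDegree ≤ 8 := by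
    rw [polyA, polyB, polyC]
    compute_degree
    norm_num
  have h2 : (T ^ 2).natDegree ≤ 8 := by
    rw [h]
    exact (natDegree_sub_le_of_le (natDegree_pow_le_of_le 2 hU) hd).trans (by norm_num)
  rw [natDegree_pow] at h2
  omega

/-- The only simultaneous representation of `a(b - c)` and `b(a - c)` as differences of squares
`U² - W²` and `U² - V²` is the one with `U = ±(a + b - c) / 2`. -/
theorem four_mul_sq_eq {U V W : ℚ[X]} (h₁ : U ^ 2 - W ^ 2 = polyA * (polyB - polyC))
    (h₂ : U ^ 2 - V ^ 2 = polyB * (polyA - polyC)) :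
    4 * U ^ 2 = (polyA + (polyB - polyC)) ^ 2 := by
  -- The prime `a` divides `U + W` or `U - W`; changing the sign of `W` exchanges them.
  wlog hA : polyA ∣ U + W generalizing W
  · have hdvd : polyA ∣ (U + W) * (U - W) := ⟨polyB - polyC, by linear_combination h₁⟩
    refine this (W := -W) (by rw [neg_sq, h₁]) ?_
    simpa [sub_eq_add_neg] using (prime_polyA.dvd_or_dvd hdvd).resolve_left hA
  have hA0 := prime_polyA.ne_zero
  have hD0 := prime_polyB_sub_polyC.ne_zero
  have hV : (2 * V) ^ 2 = (2 * U) ^ 2 - C 4 * (polyB * (polyA - polyC)) := by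
    rw [show (C 4 : ℚ[X]) = 4 from rfl]
    linear_combination -4 * h₂
  obtain ⟨g, hg⟩ := hA
  have hgD : g * (U - W) = polyB - polyC :=
    mul_left_cancel₀ hA0 (by linear_combination h₁ - (U - W) * hg)
  have hconst : ∀ p q : ℚ[X], p * q = 1 → ∃ s r : ℚ, s * r = 1 ∧ p = C s ∧ q = C r := by
    intro p q hpq
    obtain ⟨s, -, rfl⟩ := Polynomial.isUnit_iff.1 (IsUnit.of_mul_eq_one _ hpq)
    obtain ⟨r, -, rfl⟩ := Polynomial.isUnit_iff.1 (IsUnit.of_mul_eq_one_right _ hpq)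
    exact ⟨s, r, C_injective (by rw [C_mul, hpq, C_1]), rfl, rfl⟩
  -- The prime `b - c` goes either with `a` into `U + W`, or alone into `U - W`; the remaining
  -- factors are constants `s`, `r` with `s r = 1`.
  rcases prime_polyB_sub_polyC.dvd_or_dvd ⟨1, by rw [hgD, mul_one]⟩ with ⟨f, hf⟩ | ⟨f, hf⟩
  · obtain ⟨s, r, hsr, rfl, hr⟩ := hconst f (U - W)
      (mul_left_cancel₀ hD0 (by rw [mul_one, ← mul_assoc, ← hf, hgD]))
    have hU : 2 * U = C s * (polyA * (polyB - polyC)) + C r := by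
      rw [hf] at hg
      linear_combination hg + hr
    have hdeg : (2 * U).natDegree ≤ 4 := by
      rw [hU, polyB_sub_polyC_eq, polyA_eq]
      compute_degree
    obtain ⟨t₀, t₁, t₂, t₃, t₄, ht⟩ :=
      exists_eval_eq_of_natDegree_le_four (natDegree_le_four_of_sq_eq hdeg hV)
    refine (not_quartic_splitting hsr (t₀ := t₀) (t₁ := t₁) (t₂ := t₂) (t₃ := t₃) (t₄ := t₄)
      fun t => ?_).elim
    have e := congrArg (eval t) hV
    rw [hU] at e
    simp only [eval_pow, ht, eval_sub, eval_add, eval_mul, eval_C, polyA_eval, polyB_eval,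
      polyC_eval] at e
    linear_combination e
  · obtain ⟨s, r, hsr, rfl, rfl⟩ := hconst g f
      (mul_left_cancel₀ hD0 (by linear_combination hgD - g * hf))
    have hU : 2 * U = C s * polyA + C r * (polyB - polyC) := by
      linear_combination hg + hf
    have hdeg : (2 * U).natDegree ≤ 4 := by
      rw [hU, polyB_sub_polyC_eq, polyA_eq]
      compute_degree
      norm_num
    obtain ⟨t₀, t₁, t₂, t₃, t₄, ht⟩ :=
      exists_eval_eq_of_natDegree_le_four (natDegree_le_four_of_sq_eq hdeg hV)
    obtain rfl : s = r := eq_of_quadratic_splitting hsr (t₀ := t₀) (t₁ := t₁) (t₂ := t₂)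
      (t₃ := t₃) (t₄ := t₄) fun t => by
        have e := congrArg (eval t) hV
        rw [hU] at e
        simp only [eval_pow, ht, eval_sub, eval_add, eval_mul, eval_C, polyA_eval, polyB_eval,
          polyC_eval] at e
        linear_combination e
    have hs : (C s : ℚ[X]) * C s = 1 := by rw [← C_mul, hsr, C_1]
    linear_combination (2 * U + C s * polyA + C s * (polyB - polyC)) * hU +
      (polyA + (polyB - polyC)) ^ 2 * hs

end Sides

/-! ### The curve over `ℚ(k)`: discriminant, specialisation, valuations -/

section HeronCurve

open Polynomial WeierstrassCurve Affine

theorem algebraMap_polyA : algebraMap ℚ[X] (RatFunc ℚ) polyA = sideA := by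
  simp only [polyA, sideA, map_add, map_sub, map_mul, map_pow, map_ofNat, RatFunc.algebraMap_X]

theorem algebraMap_polyB : algebraMap ℚ[X] (RatFunc ℚ) polyB = sideB := by
  simp only [polyB, sideB, map_add, map_sub, map_mul, map_pow, map_ofNat, RatFunc.algebraMap_X,
    RatFunc.algebraMap_C, map_div₀, map_one]
  ring

theorem algebraMap_polyC : algebraMap ℚ[X] (RatFunc ℚ) polyC = sideC := by
  simp only [polyC, sideC, map_add, map_sub, map_mul, map_pow, map_ofNat, RatFunc.algebraMap_X,
    RatFunc.algebraMap_C, map_div₀, map_one]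
  ring

/-- `ℚ[X]` is integrally closed, so a rational function whose square is a polynomial is a
polynomial. -/
theorem exists_algebraMap_sq_eq {u : RatFunc ℚ} {p : ℚ[X]}
    (h : u ^ 2 = algebraMap ℚ[X] (RatFunc ℚ) p) : ∃ U : ℚ[X], U ^ 2 = p := by
  obtain ⟨U, rfl⟩ := IsIntegrallyClosed.exists_algebraMap_eq_of_isIntegral_pow (R := ℚ[X])
    two_pos (h ▸ isIntegral_algebraMap)
  exact ⟨U, RatFunc.algebraMap_injective ℚ (by rw [map_pow, h])⟩

theorem not_isSquare_algebraMap {p : ℚ[X]} {t : ℚ} (hp : ¬ IsSquare (p.eval t)) :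
    ¬ IsSquare (algebraMap ℚ[X] (RatFunc ℚ) p) := by
  rintro ⟨u, hu⟩
  obtain ⟨U, rfl⟩ := exists_algebraMap_sq_eq ((pow_two u).trans hu.symm)
  exact hp ⟨U.eval t, by simp [pow_two]⟩

theorem heronCurve_Δ : heronCurve.Δ = 16 * (sideA * sideB * sideC) ^ 2 *
    ((sideA - sideB) * (sideA - sideC) * (sideB - sideC)) ^ 2 := by
  simp only [heronCurve, triangleCurve, WeierstrassCurve.Δ, WeierstrassCurve.b₂,
    WeierstrassCurve.b₄, WeierstrassCurve.b₆, WeierstrassCurve.b₈]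
  ring

theorem algebraMap_ne_zero_of_eval {p : ℚ[X]} (t : ℚ) (hp : p.eval t ≠ 0) :
    algebraMap ℚ[X] (RatFunc ℚ) p ≠ 0 := by
  rw [Ne, FaithfulSMul.algebraMap_eq_zero_iff]
  rintro rfl
  simp at hp

theorem sideA_ne_zero : sideA ≠ 0 := by
  rw [← algebraMap_polyA]
  exact algebraMap_ne_zero_of_eval 1 (by norm_num [polyA_eval])

theorem sideB_ne_zero : sideB ≠ 0 := by
  rw [← algebraMap_polyB]
  exact algebraMap_ne_zero_of_eval 1 (by norm_num [polyB_eval])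

theorem sideC_ne_zero : sideC ≠ 0 := by
  rw [← algebraMap_polyC]
  exact algebraMap_ne_zero_of_eval 1 (by norm_num [polyC_eval])

theorem sideA_sub_sideB_ne_zero : sideA - sideB ≠ 0 := by
  rw [← algebraMap_polyA, ← algebraMap_polyB, ← map_sub]
  exact algebraMap_ne_zero_of_eval 1 (by norm_num [polyA_eval, polyB_eval])

theorem sideA_sub_sideC_ne_zero : sideA - sideC ≠ 0 := by
  rw [← algebraMap_polyA, ← algebraMap_polyC, ← map_sub]
  exact algebraMap_ne_zero_of_eval 1 (by norm_num [polyA_eval, polyC_eval])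

theorem sideB_sub_sideC_ne_zero : sideB - sideC ≠ 0 := by
  rw [← algebraMap_polyB, ← algebraMap_polyC, ← map_sub]
  exact algebraMap_ne_zero_of_eval 1 (by norm_num [polyB_eval, polyC_eval])

theorem heronCurve_isElliptic : heronCurve.IsElliptic := by
  refine ⟨isUnit_iff_ne_zero.2 ?_⟩
  rw [heronCurve_Δ]
  simp [sideA_ne_zero, sideB_ne_zero, sideC_ne_zero, sideA_sub_sideB_ne_zero,
    sideA_sub_sideC_ne_zero, sideB_sub_sideC_ne_zero]

/-- Nonzero constants are units of `ℚ[X]`, so every finite place has residue characteristic zero. -/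
theorem valuation_natCast_eq_one (v : IsDedekindDomain.HeightOneSpectrum ℚ[X]) (n : ℕ)
    (hn : n ≠ 0) : v.valuation (RatFunc ℚ) (n : RatFunc ℚ) = 1 := by
  have h := v.valuation_le_one (K := RatFunc ℚ)
  have hn' : (n : ℚ) ≠ 0 := by exact_mod_cast hn
  have e : (n : RatFunc ℚ) = algebraMap ℚ[X] (RatFunc ℚ) (n : ℚ[X]) := by simp
  have e' : (n : RatFunc ℚ) * algebraMap ℚ[X] (RatFunc ℚ) (C (n : ℚ)⁻¹) = 1 := by
    rw [e, ← map_mul, ← map_natCast (C : ℚ →+* ℚ[X]), ← C_mul, mul_inv_cancel₀ hn', C_1, map_one]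
  refine le_antisymm (e ▸ h _) ?_
  rw [← map_one (v.valuation (RatFunc ℚ)), ← e', map_mul]
  exact mul_le_of_le_one_right' (h _)

/-! ### Torsion points of `heronCurve` -/

variable [DecidableEq (RatFunc ℚ)]

/-- A point of odd order on `heronCurve` has polynomial first coordinate. -/
theorem exists_algebraMap_eq_of_odd {x y : RatFunc ℚ} (h : heronCurve.Nonsingular x y) {m : ℕ}
    (hm : Odd m) (hP : m • Point.some x y h = 0) :
    ∃ p, algebraMap ℚ[X] (RatFunc ℚ) p = x :=
  IsDedekindDomain.HeightOneSpectrum.mem_integers_of_valuation_le_one (RatFunc ℚ) x fun v =>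
    triangleCurve_valuation_le_one (v.valuation (RatFunc ℚ)) (valuation_natCast_eq_one v)
      (algebraMap_polyA ▸ v.valuation_le_one _) (algebraMap_polyB ▸ v.valuation_le_one _)
      (algebraMap_polyC ▸ v.valuation_le_one _) h hm hP

theorem heronCurve_two_nsmul_of_y_eq_zero {x y : RatFunc ℚ} (h : heronCurve.Nonsingular x y)
    (hy : y = 0) : 2 • Point.some x y h = 0 :=
  triangleCurve_two_nsmul_of_y_eq_zero h hy

theorem heronCurve_two_nsmul {x y : RatFunc ℚ} (h : heronCurve.Nonsingular x y) (hy : y ≠ 0) :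
    ∃ (x' y' : RatFunc ℚ) (h' : heronCurve.Nonsingular x' y'),
      2 • Point.some x y h = Point.some x' y' h' ∧
      (x' + sideA * sideB) * (2 * y) ^ 2 = ((x + sideA * sideB) ^ 2 -
        (sideB * sideC - sideA * sideB) * (sideA * sideC - sideA * sideB)) ^ 2 ∧
      (x' + sideB * sideC) * (2 * y) ^ 2 = ((x + sideB * sideC) ^ 2 -
        (sideA * sideB - sideB * sideC) * (sideA * sideC - sideB * sideC)) ^ 2 ∧
      (x' + sideA * sideC) * (2 * y) ^ 2 = ((x + sideA * sideC) ^ 2 -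
        (sideA * sideB - sideA * sideC) * (sideB * sideC - sideA * sideC)) ^ 2 :=
  triangleCurve_two_nsmul two_ne_zero h hy

/-- The first coordinate of a double, shifted by any root of the cubic, is a square. -/
theorem heronCurve_sq_of_two_nsmul {Q : heronCurve.Point} {x y : RatFunc ℚ}
    {h : heronCurve.Nonsingular x y} (hQ : 2 • Q = Point.some x y h) :
    IsSquare (x + sideA * sideB) ∧ IsSquare (x + sideB * sideC) ∧
      IsSquare (x + sideA * sideC) := by
  rcases Q with _ | ⟨x₁, y₁, h₁⟩
  · exact absurd (hQ.symm.trans (nsmul_zero 2)) (Point.some_ne_zero h)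
  · by_cases hy : y₁ = 0
    · exact absurd (hQ.symm.trans (heronCurve_two_nsmul_of_y_eq_zero h₁ hy))
        (Point.some_ne_zero h)
    · obtain ⟨x', y', h', e, e₁, e₂, e₃⟩ := heronCurve_two_nsmul h₁ hy
      obtain ⟨rfl, -⟩ := (Point.some.injEq ..).mp (e.symm.trans hQ)
      have key : ∀ u w : RatFunc ℚ, u * (2 * y₁) ^ 2 = w ^ 2 → IsSquare u := fun u w hu =>
        ⟨w / (2 * y₁), by rw [← pow_two, div_pow, ← hu, mul_div_cancel_right₀ _ (by simp [hy])]⟩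
      exact ⟨key _ _ e₁, key _ _ e₂, key _ _ e₃⟩

/-- No point of order two on `heronCurve` is a double. -/
theorem two_nsmul_ne_some_zero (Q : heronCurve.Point) {x : RatFunc ℚ}
    (h : heronCurve.Nonsingular x 0) : 2 • Q ≠ Point.some x 0 h := by
  intro hQ
  have h0 := (triangleCurve_equation_iff _ _ _ _ _).1 h.1
  obtain ⟨s₁, s₂, s₃⟩ := heronCurve_sq_of_two_nsmul hQ
  have n₁ : ¬ IsSquare (65 : ℚ) := by
    rw [show (65 : ℚ) = ((65 : ℕ) : ℚ) by norm_num, Rat.isSquare_natCast_iff]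
    decide +kernel
  have n₂ : ¬ IsSquare (-65 : ℚ) := fun h => by
    have := h.nonneg
    norm_num at this
  have n₃ : ¬ IsSquare (323 / 4 : ℚ) := by
    rintro ⟨t, ht⟩
    have : IsSquare (323 : ℚ) := ⟨2 * t, by linear_combination 4 * ht⟩
    rw [show (323 : ℚ) = ((323 : ℕ) : ℚ) by norm_num, Rat.isSquare_natCast_iff] at this
    revert this
    decide +kernel
  rw [zero_pow two_ne_zero, eq_comm, mul_eq_zero, mul_eq_zero] at h0
  rcases h0 with (e | e) | e
  -- At `k = 1` the sides are `5`, `17/2`, `-9/2`, so `a(b - c) = 65` and `b(a - c) = 323/4`.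
  · refine not_isSquare_algebraMap (p := polyA * (polyC - polyB)) (t := 1) ?_ ?_
    · norm_num [polyA_eval, polyB_eval, polyC_eval, n₂]
    · rw [map_mul, map_sub, algebraMap_polyA, algebraMap_polyB, algebraMap_polyC]
      convert s₃ using 1
      linear_combination -e
  · refine not_isSquare_algebraMap (p := polyB * (polyA - polyC)) (t := 1) ?_ ?_
    · norm_num [polyA_eval, polyB_eval, polyC_eval, n₃]
    · rw [map_mul, map_sub, algebraMap_polyA, algebraMap_polyB, algebraMap_polyC]
      convert s₁ using 1
      linear_combination -e
  · refine not_isSquare_algebraMap (p := polyA * (polyB - polyC)) (t := 1) ?_ ?_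
    · norm_num [polyA_eval, polyB_eval, polyC_eval, n₁]
    · rw [map_mul, map_sub, algebraMap_polyA, algebraMap_polyB, algebraMap_polyC]
      convert s₁ using 1
      linear_combination -e

/-- An affine point of odd order on `heronCurve` has first coordinate
`((a + b - c) / 2)² - ab`. -/
theorem x_eq_of_odd {x y : RatFunc ℚ} (h : heronCurve.Nonsingular x y) {m : ℕ}
    (hm : Odd m) (hP : m • Point.some x y h = 0) :
    ∃ p : ℚ[X], algebraMap ℚ[X] (RatFunc ℚ) p = x ∧
      4 * (p + polyA * polyB) = (polyA + (polyB - polyC)) ^ 2 := by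
  obtain ⟨p, rfl⟩ := exists_algebraMap_eq_of_odd h hm hP
  obtain ⟨n, hn, hfix⟩ := exists_two_pow_nsmul_eq_self hm hP
  obtain ⟨k, rfl⟩ := Nat.exists_eq_succ_of_ne_zero hn
  rw [Nat.succ_eq_add_one, pow_succ, mul_nsmul] at hfix
  obtain ⟨⟨u, hu⟩, ⟨v, hv⟩, ⟨w, hw⟩⟩ := heronCurve_sq_of_two_nsmul hfix
  rw [← pow_two, ← algebraMap_polyA, ← algebraMap_polyB, ← map_mul, ← map_add] at hu
  rw [← pow_two, ← algebraMap_polyB, ← algebraMap_polyC, ← map_mul, ← map_add] at hv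
  rw [← pow_two, ← algebraMap_polyA, ← algebraMap_polyC, ← map_mul, ← map_add] at hw
  obtain ⟨U, hU⟩ := exists_algebraMap_sq_eq hu.symm
  obtain ⟨V, hV⟩ := exists_algebraMap_sq_eq hv.symm
  obtain ⟨W, hW⟩ := exists_algebraMap_sq_eq hw.symm
  refine ⟨p, rfl, ?_⟩
  rw [← hU]
  exact four_mul_sq_eq (V := V) (W := W) (by linear_combination hU - hW)
    (by linear_combination hU - hV)

theorem eq_zero_of_odd {P : heronCurve.Point} {m : ℕ} (hm : Odd m) (hP : m • P = 0) : P = 0 := by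
  rcases P with _ | ⟨x, y, h⟩
  · rfl
  exfalso
  obtain ⟨p, rfl, hp⟩ := x_eq_of_odd h hm hP
  have heq := (triangleCurve_equation_iff _ _ _ _ _).1 h.1
  have hy : y ≠ 0 := by
    intro hy
    obtain ⟨n, hn, hfix⟩ := exists_two_pow_nsmul_eq_self hm hP
    obtain ⟨k, rfl⟩ := Nat.exists_eq_succ_of_ne_zero hn
    rw [Nat.succ_eq_add_one, pow_succ', mul_nsmul,
      heronCurve_two_nsmul_of_y_eq_zero h hy, nsmul_zero] at hfix
    exact Point.some_ne_zero h hfix.symm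
  obtain ⟨x', y', h', e, e₁, -⟩ := heronCurve_two_nsmul h hy
  -- `2P` is also killed by `m`, so `x_eq_of_odd` gives it the same first coordinate as `P`.
  obtain ⟨p', rfl, hp'⟩ := x_eq_of_odd h' hm (by rw [← e, nsmul_left_comm, hP, nsmul_zero])
  obtain rfl : p' = p := by
    have : (4 : ℚ[X]) ≠ 0 := by norm_num
    exact add_right_cancel (mul_left_cancel₀ this (hp'.trans hp.symm))
  have key : 4 * (p' + polyA * polyB) *
      ((p' + polyA * polyB) * (p' + polyB * polyC) * (p' + polyA * polyC)) =
      ((p' + polyA * polyB) ^ 2 - (polyB * polyC - polyA * polyB) *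
        (polyA * polyC - polyA * polyB)) ^ 2 := by
    refine RatFunc.algebraMap_injective ℚ ?_
    simp only [map_mul, map_add, map_sub, map_pow, map_ofNat, algebraMap_polyA, algebraMap_polyB,
      algebraMap_polyC]
    linear_combination e₁ - 4 * (algebraMap ℚ[X] (RatFunc ℚ) p' + sideA * sideB) * heq
  have k₁ := congrArg (eval 1) key
  have k₂ := congrArg (eval 1) hp
  norm_num [polyA_eval, polyB_eval, polyC_eval] at k₁ k₂
  obtain hx : p'.eval 1 = 77 / 2 := by linarith
  rw [hx] at k₁
  norm_num at k₁

theorem two_nsmul_eq_zero_iff {P : heronCurve.Point} :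
    2 • P = 0 ↔ P = 0 ∨ ∃ x h, P = Point.some x 0 h := by
  constructor
  · intro hP
    rcases P with _ | ⟨x, y, h⟩
    · exact Or.inl rfl
    · by_cases hy : y = 0
      · subst hy
        exact Or.inr ⟨x, h, rfl⟩
      · obtain ⟨x', y', h', e, -⟩ := heronCurve_two_nsmul h hy
        exact absurd (e.symm.trans hP) (Point.some_ne_zero h')
  · rintro (rfl | ⟨x, h, rfl⟩)
    · exact nsmul_zero 2
    · exact heronCurve_two_nsmul_of_y_eq_zero h rfl

theorem two_nsmul_eq_zero_of_isOfFinAddOrder {P : heronCurve.Point} (hP : IsOfFinAddOrder P) :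
    2 • P = 0 := by
  obtain ⟨n, hn, hnP⟩ := isOfFinAddOrder_iff_nsmul_eq_zero.1 hP
  obtain ⟨a, m, hm, rfl⟩ := Nat.exists_eq_two_pow_mul_odd hn.ne'
  have h2 : 2 ^ a • P = 0 := eq_zero_of_odd hm (by rw [← mul_nsmul, hnP])
  clear hnP hn hP
  induction a generalizing P with
  | zero =>
    rw [pow_zero, one_nsmul] at h2
    rw [h2, nsmul_zero]
  | succ a ih =>
    -- By induction `2P` is killed by 2; were it nonzero, it would be a point of order two that is a
    -- double.
    rcases two_nsmul_eq_zero_iff.1 (ih (P := 2 • P) (by rwa [← mul_nsmul, ← pow_succ'])) with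
      h | ⟨x, h, e⟩
    · exact h
    · exact absurd e (two_nsmul_ne_some_zero P h)

theorem mem_torsion_heronCurve_iff {P : heronCurve.Point} :
    P ∈ AddCommGroup.torsion heronCurve.Point ↔ 2 • P = 0 :=
  ⟨two_nsmul_eq_zero_of_isOfFinAddOrder,
    fun h => isOfFinAddOrder_iff_nsmul_eq_zero.2 ⟨2, two_pos, h⟩⟩

theorem coe_torsion_heronCurve (h₁ : heronCurve.Nonsingular (-(sideA * sideB)) 0)
    (h₂ : heronCurve.Nonsingular (-(sideB * sideC)) 0)
    (h₃ : heronCurve.Nonsingular (-(sideA * sideC)) 0) :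
    (AddCommGroup.torsion heronCurve.Point : Set heronCurve.Point) =
      {0, Point.some _ _ h₁, Point.some _ _ h₂, Point.some _ _ h₃} := by
  ext P
  rw [SetLike.mem_coe, mem_torsion_heronCurve_iff, two_nsmul_eq_zero_iff]
  simp only [Set.mem_insert_iff, Set.mem_singleton_iff]
  refine or_congr_right ⟨?_, ?_⟩
  · rintro ⟨x, h, rfl⟩
    have h0 := (triangleCurve_equation_iff _ _ _ _ _).1 h.1
    rw [zero_pow two_ne_zero, eq_comm, mul_eq_zero, mul_eq_zero] at h0
    rcases h0 with (e | e) | e <;> obtain rfl := eq_neg_of_add_eq_zero_left e <;> simp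
  · rintro (rfl | rfl | rfl)
    exacts [⟨_, h₁, rfl⟩, ⟨_, h₂, rfl⟩, ⟨_, h₃, rfl⟩]

theorem isAddKleinFour_torsion_heronCurve (h₁ : heronCurve.Nonsingular (-(sideA * sideB)) 0)
    (h₂ : heronCurve.Nonsingular (-(sideB * sideC)) 0)
    (h₃ : heronCurve.Nonsingular (-(sideA * sideC)) 0) :
    IsAddKleinFour (AddCommGroup.torsion heronCurve.Point) := by
  have hcard : Nat.card (AddCommGroup.torsion heronCurve.Point) = 4 := by
    have n₁₂ : -(sideA * sideB) ≠ -(sideB * sideC) := fun h =>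
      mul_ne_zero sideB_ne_zero sideA_sub_sideC_ne_zero (by linear_combination -h)
    have n₁₃ : -(sideA * sideB) ≠ -(sideA * sideC) := fun h =>
      mul_ne_zero sideA_ne_zero sideB_sub_sideC_ne_zero (by linear_combination -h)
    have n₂₃ : -(sideB * sideC) ≠ -(sideA * sideC) := fun h =>
      mul_ne_zero sideC_ne_zero sideA_sub_sideB_ne_zero (by linear_combination h)
    change Nat.card (AddCommGroup.torsion heronCurve.Point : Set heronCurve.Point) = 4
    rw [coe_torsion_heronCurve h₁ h₂ h₃, Nat.card_coe_set_eq, Set.ncard_insert_of_notMem,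
      Set.ncard_insert_of_notMem, Set.ncard_pair]
    · simpa only [Ne, Point.some.injEq, and_true] using n₂₃
    · simp only [Set.mem_insert_iff, Set.mem_singleton_iff, Point.some.injEq, and_true, not_or]
      exact ⟨n₁₂, n₁₃⟩
    · simp only [Set.mem_insert_iff, Set.mem_singleton_iff, not_or]
      exact ⟨(Point.some_ne_zero h₁).symm, (Point.some_ne_zero h₂).symm,
        (Point.some_ne_zero h₃).symm⟩
  refine ⟨hcard, ?_⟩
  have hdvd : AddMonoid.exponent (AddCommGroup.torsion heronCurve.Point) ∣ 2 :=
    AddMonoid.exponent_dvd_of_forall_nsmul_eq_zero fun P =>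
      Subtype.ext (mem_torsion_heronCurve_iff.1 P.2)
  refine (Nat.prime_two.eq_one_or_self_of_dvd _ hdvd).resolve_left fun h => ?_
  have := AddMonoid.exp_eq_one_iff.1 h
  rw [Nat.card_unique] at hcard
  norm_num at hcard

end HeronCurve

theorem theorem2p1 [DecidableEq (RatFunc ℚ)] :
    heronCurve.IsElliptic ∧
    Nonempty (AddCommGroup.torsion heronCurve.Point ≃+ ZMod 2 × ZMod 2) ∧
    ∃ (h₁ : heronCurve.Nonsingular (-(sideA * sideB)) 0)
      (h₂ : heronCurve.Nonsingular (-(sideB * sideC)) 0)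
      (h₃ : heronCurve.Nonsingular (-(sideA * sideC)) 0),
      AddCommGroup.torsion heronCurve.Point =
        AddSubgroup.closure
          {WeierstrassCurve.Affine.Point.some _ _ h₁,
            WeierstrassCurve.Affine.Point.some _ _ h₂,
            WeierstrassCurve.Affine.Point.some _ _ h₃} ∧
      (AddCommGroup.torsion heronCurve.Point : Set heronCurve.Point) =
        {0, WeierstrassCurve.Affine.Point.some _ _ h₁,
          WeierstrassCurve.Affine.Point.some _ _ h₂,
          WeierstrassCurve.Affine.Point.some _ _ h₃} := by
  have hE := heronCurve_isElliptic
  have hns : ∀ x, (x + sideA * sideB) * (x + sideB * sideC) * (x + sideA * sideC) = 0 →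
      heronCurve.Nonsingular x 0 := fun x hx =>
    WeierstrassCurve.Affine.equation_iff_nonsingular.1
      ((triangleCurve_equation_iff _ _ _ _ _).2 (by rw [hx, zero_pow two_ne_zero]))
  have h₁ := hns (-(sideA * sideB)) (by ring)
  have h₂ := hns (-(sideB * sideC)) (by ring)
  have h₃ := hns (-(sideA * sideC)) (by ring)
  have hT := coe_torsion_heronCurve h₁ h₂ h₃
  have := isAddKleinFour_torsion_heronCurve h₁ h₂ h₃
  refine ⟨hE, IsAddKleinFour.nonempty_addEquiv, h₁, h₂, h₃, le_antisymm ?_ ?_, hT⟩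
  · intro P hP
    rw [← SetLike.mem_coe, hT, Set.mem_insert_iff] at hP
    rcases hP with rfl | hP
    · exact zero_mem _
    · exact AddSubgroup.subset_closure hP
  · rw [AddSubgroup.closure_le, hT]
    exact Set.subset_insert _ _
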